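/- Let $G$ be a finitely generated group. For a subset $X$ of $G$ write $X^{*}=G\setminus X$. For a subgroup $H$ of $G$, let $H\backslash G$ be the set of cosets $Hg$, on which $G$ acts on the right. A subset $W\subseteq G$ is *$H$-finite* if it is contained in a union of finitely many cosets $Hg$. A subset $X\subseteq G$ is *$H$-almost invariant* if $hX=X$ for all $h\in H$ and the image $H\backslash X$ of $X$ in $H\backslash G$ has finite symmetric difference with $(H\backslash X)g$ for every $g\in G$; it is *nontrivial* if $H\backslash X$ and $H\backslash X^{*}$ are both infinite. An $H$-almost invariant set $X$ and a $K$-almost invariant set $Y$ are *equivalent* if their symmetric difference is $H$-finite. If $U$ and $V$ are nontrivial almost invariant sets over some subgroups $H$ and $K$, then $U\cap V$ is *small* if it is $H$-finite (this does not depend on the choice of $H$). The *corners* of $(U,V)$ are the four sets $U\cap V$, $U\cap V^{*}$, $U^{*}\cap V$, $U^{*}\cap V^{*}$. For nontrivial almost invariant sets $Y_1,\dots,Y_n$ over finitely generated subgroups of $G$, put $E(Y_1,\dots,Y_n)=\{gY_i,\ gY_i^{*}: g\in G,\ 1\le i\le n\}$; the family is in *good position* if, whenever $U,V\in E(Y_1,\dots,Y_n)$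 have at least two small corners, one of their corners is empty. For $U,V\in E(Y_1,\dots,Y_n)$, write $U\le V$ if $U\cap V^{*}$ is empty or is the only small set among the four corners of $(U,V)$. **Lemma.** Let $G$ be a finitely generated group with finitely generated subgroups $H_1,\dots,H_n$, and for $i=1,\dots,n$ let $X_i$ be a nontrivial $H_i$-almost invariant subset of $G$. Then there are finitely generated subgroups $K_1,\dots,K_n$ of $G$ and nontrivial $K_i$-almost invariant subsets $Y_i$ of $G$ such that each $Y_i$ is equivalent to $X_i$, the family $Y_1,\dots,Y_n$ is in good position, and the relation $\le$ is a partial order on $E(Y_1,\dots,Y_n)$. -/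

import Mathlib

open scoped Pointwise

namespace AlmostInvariant

variable {G : Type*} [Group G]

/-- The set `H \ G` of cosets `Hg`, the quotient of `G` by left multiplication by `H`. -/
abbrev CosetSpace (H : Subgroup G) : Type _ := Quotient (QuotientGroup.rightRel H)

/-- The projection `G → H \ G`, `g ↦ Hg`. -/
def proj (H : Subgroup G) (g : G) : CosetSpace H := Quotient.mk (QuotientGroup.rightRel H) g

/-- The right action of `G` on `H \ G`: the map `Hx ↦ Hxg`. -/
def rightTranslate (H : Subgroup G) (g : G) : CosetSpace H → CosetSpace H :=
  Quotient.map (fun x => x * g) (by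
    intro a b hab
    have h : QuotientGroup.rightRel H a b := hab
    rw [QuotientGroup.rightRel_apply] at h
    change QuotientGroup.rightRel H (a * g) (b * g)
    rw [QuotientGroup.rightRel_apply]
    simpa [mul_assoc] using h)

/-- `P ⊆ H \ G` is almost invariant: `Pg` and `P` differ by a finite set, for every `g`. -/
def IsAlmostInvariantInQuotient (H : Subgroup G) (P : Set (CosetSpace H)) : Prop :=
  ∀ g : G, (symmDiff (rightTranslate H g '' P) P).Finite

/-- `X ⊆ G` is `H`-almost invariant. -/
structure IsAlmostInvariant (H : Subgroup G) (X : Set G) : Prop where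
  left_invariant : ∀ h ∈ H, h • X = X
  almost_invariant : IsAlmostInvariantInQuotient H (proj H '' X)

/-- `X ⊆ G` is a nontrivial `H`-almost invariant set: moreover `H \ X` and `H \ X*` are infinite,
where `X*` is the complement of `X`. -/
structure IsNontrivialAlmostInvariant (H : Subgroup G) (X : Set G) : Prop
    extends IsAlmostInvariant H X where
  infinite : (proj H '' X).Infinite
  infinite_compl : (proj H '' Xᶜ).Infinite

/-- `W` is `H`-finite: it lies in the union of finitely many cosets `Hg`. -/
def IsHFinite (H : Subgroup G) (W : Set G) : Prop :=
  ∃ F : Finset G, W ⊆ (H : Set G) * (F : Set G)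

/-- `V` and `W` are `H`-almost equal. -/
def IsHAlmostEqual (H : Subgroup G) (V W : Set G) : Prop := IsHFinite H (symmDiff V W)

/-- The `H`-almost invariant set `X` and the `K`-almost invariant set `Y` are equivalent. -/
structure IsEquivalent (H K : Subgroup G) (X Y : Set G) : Prop where
  left : IsAlmostInvariant H X
  right : IsAlmostInvariant K Y
  almost_equal : IsHAlmostEqual H X Y

/-- `U ∩ V` is small: it is `H`-finite, where `U` is a nontrivial `H`-almost invariant set.
Any two subgroups over which `U` is nontrivial almost invariant are commensurable,
so it does not matter which such `H` is used. -/
def IsSmall (U V : Set G) : Prop :=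
  ∃ H : Subgroup G, IsNontrivialAlmostInvariant H U ∧ IsHFinite H (U ∩ V)

/-- `U` or its complement `U*`. -/
def side (U : Set G) : Bool → Set G
  | true => U
  | false => Uᶜ

/-- The four corners `U ∩ V`, `U ∩ V*`, `U* ∩ V`, `U* ∩ V*` of the pair `(U, V)`, indexed by
`(true, true)`, `(true, false)`, `(false, true)`, `(false, false)`. -/
def corner (U V : Set G) (c : Bool × Bool) : Set G := side U c.1 ∩ side V c.2

/-- The corner of `(U, V)` with index `c` is small. -/
def CornerSmall (U V : Set G) (c : Bool × Bool) : Prop := IsSmall (side U c.1) (side V c.2)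

/-- `E(X₁, …, Xₙ)`: all translates of the `Xᵢ` and of their complements. -/
def translates {ι : Type*} (X : ι → Set G) : Set (Set G) :=
  {U | ∃ (g : G) (i : ι), U = g • X i ∨ U = g • (X i)ᶜ}

/-- Good position, i.e. Condition (*) for `E(X₁, …, Xₙ)`: if two of the four corners of two members
are small, then one of their corners is empty. -/
def InGoodPosition {ι : Type*} (X : ι → Set G) : Prop :=
  ∀ U ∈ translates X, ∀ V ∈ translates X, ∀ c d : Bool × Bool, c ≠ d →
    CornerSmall U V c → CornerSmall U V d → ∃ e : Bool × Bool, corner U V e = ∅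

/-- The relation `U ≤ V`: the corner `U ∩ V*` is empty, or it is the only small one among the four
corners of `U` and `V`. -/
def AlmostLE (U V : Set G) : Prop :=
  corner U V (true, false) = ∅ ∨ ∀ c : Bool × Bool, CornerSmall U V c ↔ c = (true, false)

end AlmostInvariant

namespace AlmostInvariant

open MulAction

/-! Fix `i` and let `T` be the class of all translates of the `X k` and their complements that are
almost equal to `X i`. Only finitely many members of `T` separate two given points
(`finite_translates_separating`), so although a point may lie in infinitely many members, two points
can be compared by how many contain one and not the other. This gives a total preorder on `G`,
depth, and the sets closed under going deeper form a chain (`IsDeepClosed.subset_or_subset`). The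
new set `Y i` is the deep closure of `X i`.

Depth depends only on the almost-equality class; translation carries it along and complementation
reverses it. Hence any two almost equal members of `E(Y)` are closed for one and the same preorder,
so they are nested. Nesting suffices: two small corners make the sets almost equal up to complements
(`AlmostEq.of_cornerSmall`), which yields an empty corner and also removes the only obstruction to
transitivity (`AlmostLE.trans`).

It remains to see that `Y i` is equivalent to `X i`. A point of `Y i \ X i` lies in some `V ∈ T` not
nested with `X i` (`exists_mem_of_mem_deepClosure`), and there are only finitely many such `V`
(`finite_translates_incomparable`). For the latter, finite generation of the subgroups puts each
boundary in a connected neighbourhood in a Cayley graph; almost equal sets with disjoint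
neighbourhoods are nested, and only finitely many neighbourhoods meet the given one, up to a finite
ambiguity. -/

lemma side_not {G : Type*} (U : Set G) (b : Bool) : side U (!b) = (side U b)ᶜ := by
  cases b <;> simp [side]

/-! ### Finiteness modulo a subgroup, smallness and almost equality -/

section Basic

variable {G : Type*} [Group G] {H L : Subgroup G} {P U V W X Y Z : Set G}

lemma IsHFinite.mono (hW : IsHFinite H W) (h : Z ⊆ W) : IsHFinite H Z := by
  obtain ⟨F, hF⟩ := hW
  exact ⟨F, h.trans hF⟩

lemma IsHFinite.union (hZ : IsHFinite H Z) (hW : IsHFinite H W) : IsHFinite H (Z ∪ W) := by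
  classical
  obtain ⟨F, hF⟩ := hZ
  obtain ⟨F', hF'⟩ := hW
  refine ⟨F ∪ F', ?_⟩
  rw [Finset.coe_union, Set.mul_union]
  exact Set.union_subset_union hF hF'

lemma isHFinite_empty : IsHFinite H (∅ : Set G) := ⟨∅, Set.empty_subset _⟩

lemma isHFinite_biUnion {ι : Type*} {s : Set ι} (hs : s.Finite) {f : ι → Set G}
    (h : ∀ i ∈ s, IsHFinite H (f i)) : IsHFinite H (⋃ i ∈ s, f i) := by
  induction s, hs using Set.Finite.induction_on with
  | empty => simpa using isHFinite_empty
  | @insert a s _ _ ih =>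
    rw [Set.biUnion_insert]
    exact (h a (Set.mem_insert _ _)).union (ih fun i hi => h i (Set.mem_insert_of_mem _ hi))

lemma IsHFinite.of_mul_right (g : G) (hW : IsHFinite H W) : IsHFinite H {x | x * g ∈ W} := by
  classical
  obtain ⟨F, hF⟩ := hW
  refine ⟨F.image (· * g⁻¹), fun x hx => ?_⟩
  obtain ⟨h, hh, f, hf, hx⟩ := Set.mem_mul.1 (hF hx)
  refine Set.mem_mul.2 ⟨h, hh, f * g⁻¹, by simpa using hf, ?_⟩
  rw [← mul_assoc, hx, mul_inv_cancel_right]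

lemma IsHFinite.of_le (hHL : H ≤ L) (hW : IsHFinite H W) : IsHFinite L W := by
  obtain ⟨F, hF⟩ := hW
  exact ⟨F, hF.trans (Set.mul_subset_mul_right hHL)⟩

lemma isHFinite_self (H : Subgroup G) : IsHFinite H (H : Set G) := ⟨{1}, by simp⟩

lemma proj_eq_iff {x y : G} : proj H x = proj H y ↔ y * x⁻¹ ∈ H := by
  unfold proj
  rw [Quotient.eq]
  exact QuotientGroup.rightRel_apply

lemma proj_image_finite_iff : (proj H '' W).Finite ↔ IsHFinite H W := by
  classical
  constructor
  · intro h
    obtain ⟨F, hF, hFW⟩ := Set.exists_subset_image_finite_and.1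
      ⟨proj H '' W, subset_rfl, h, (rfl : proj H '' W = proj H '' W)⟩
    refine ⟨hFW.1.toFinset, fun x hx => ?_⟩
    obtain ⟨f, hf, hfx⟩ : proj H x ∈ proj H '' F := hFW.2 ▸ Set.mem_image_of_mem _ hx
    exact Set.mem_mul.2 ⟨x * f⁻¹, proj_eq_iff.1 hfx, f, by simpa using hf, by simp⟩
  · rintro ⟨F, hF⟩
    refine (F.finite_toSet.image (proj H)).subset ?_
    rintro _ ⟨x, hx, rfl⟩
    obtain ⟨h, hh, f, hf, rfl⟩ := Set.mem_mul.1 (hF hx)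
    exact ⟨f, hf, proj_eq_iff.2 (by simpa using hh)⟩

lemma mem_of_smul_eq {g x : G} (hg : g • X = X) (hx : x ∈ X) : g * x ∈ X := by
  rw [← hg]
  exact Set.smul_mem_smul_set hx

lemma mul_mem_iff_of_smul_eq {g x : G} (hg : g • X = X) : g * x ∈ X ↔ x ∈ X := by
  conv_lhs => rw [← hg]
  exact Set.smul_mem_smul_set_iff

lemma proj_mem_image_iff (hX : ∀ h ∈ H, h • X = X) {x : G} : proj H x ∈ proj H '' X ↔ x ∈ X := by
  refine ⟨?_, Set.mem_image_of_mem _⟩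
  rintro ⟨y, hy, hyx⟩
  have := mem_of_smul_eq (hX _ (proj_eq_iff.1 hyx)) hy
  simpa using this

lemma symmDiff_rightTranslate (hX : ∀ h ∈ H, h • X = X) (g : G) :
    symmDiff (rightTranslate H g '' (proj H '' X)) (proj H '' X) =
      proj H '' {x | ¬(x * g⁻¹ ∈ X ↔ x ∈ X)} := by
  have key : ∀ x, proj H x ∈ rightTranslate H g '' (proj H '' X) ↔ x * g⁻¹ ∈ X := by
    intro x
    constructor
    · rintro ⟨_, ⟨y, hy, rfl⟩, hyx⟩
      have : proj H (y * g) = proj H x := hyx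
      have := mem_of_smul_eq (hX _ (proj_eq_iff.1 this)) hy
      simpa [mul_assoc] using this
    · intro hx
      exact ⟨_, ⟨_, hx, rfl⟩, show proj H (x * g⁻¹ * g) = _ by simp⟩
  have hinv : ∀ h ∈ H, h • {x | ¬(x * g⁻¹ ∈ X ↔ x ∈ X)} = {x | ¬(x * g⁻¹ ∈ X ↔ x ∈ X)} := by
    intro h hh
    ext x
    have := hX _ (H.inv_mem hh)
    rw [Set.mem_smul_set_iff_inv_smul_mem]
    simp only [Set.mem_ofPred_eq, smul_eq_mul, mul_assoc, mul_mem_iff_of_smul_eq this]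
  ext q
  obtain ⟨x, rfl⟩ : ∃ x, proj H x = q := Quotient.exists_rep q
  rw [Set.mem_symmDiff, key, proj_mem_image_iff hX, proj_mem_image_iff hinv, Set.mem_ofPred_eq]
  tauto

lemma isAlmostInvariant_iff : IsAlmostInvariant H X ↔
    (∀ h ∈ H, h • X = X) ∧ ∀ g, IsHFinite H {x | x ∈ X ∧ x * g ∉ X} := by
  constructor
  · rintro ⟨h1, h2⟩
    refine ⟨h1, fun g => ?_⟩
    have := h2 g⁻¹
    rw [symmDiff_rightTranslate h1, proj_image_finite_iff] at this
    refine this.mono fun x hx => ?_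
    have := hx.1
    have := hx.2
    simp_all
  · rintro ⟨h1, h2⟩
    refine ⟨h1, fun g => ?_⟩
    rw [symmDiff_rightTranslate h1, proj_image_finite_iff]
    refine ((h2 g⁻¹).union ((h2 g).of_mul_right g⁻¹)).mono fun x hx => ?_
    have : ¬(x * g⁻¹ ∈ X ↔ x ∈ X) := hx
    simp only [Set.mem_union, Set.mem_ofPred_eq, inv_mul_cancel_right]
    tauto

lemma isNontrivialAlmostInvariant_iff : IsNontrivialAlmostInvariant H X ↔
    IsAlmostInvariant H X ∧ ¬ IsHFinite H X ∧ ¬ IsHFinite H Xᶜ := by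
  rw [← proj_image_finite_iff, ← proj_image_finite_iff]
  exact ⟨fun h => ⟨h.1, h.2, h.3⟩, fun h => ⟨h.1, h.2.1, h.2.2⟩⟩

lemma IsNontrivialAlmostInvariant.not_isHFinite (h : IsNontrivialAlmostInvariant H X) :
    ¬ IsHFinite H X := (isNontrivialAlmostInvariant_iff.1 h).2.1

lemma IsNontrivialAlmostInvariant.not_isHFinite_compl (h : IsNontrivialAlmostInvariant H X) :
    ¬ IsHFinite H Xᶜ := (isNontrivialAlmostInvariant_iff.1 h).2.2

lemma IsAlmostInvariant.isHFinite_boundary (h : IsAlmostInvariant H X) (g : G) :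
    IsHFinite H {x | x ∈ X ∧ x * g ∉ X} := (isAlmostInvariant_iff.1 h).2 g

lemma IsAlmostInvariant.compl (h : IsAlmostInvariant H X) : IsAlmostInvariant H Xᶜ := by
  refine isAlmostInvariant_iff.2 ⟨fun k hk => ?_, fun g => ?_⟩
  · rw [Set.smul_set_compl, h.left_invariant k hk]
  · refine ((h.isHFinite_boundary g⁻¹).of_mul_right g).mono fun x hx => ?_
    have h1 : x ∉ X := hx.1
    have h2 : x * g ∈ X := not_not.1 hx.2
    exact ⟨h2, by simpa using h1⟩

lemma IsNontrivialAlmostInvariant.compl (h : IsNontrivialAlmostInvariant H X) :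
    IsNontrivialAlmostInvariant H Xᶜ :=
  isNontrivialAlmostInvariant_iff.2
    ⟨h.1.compl, h.not_isHFinite_compl, by simpa using h.not_isHFinite⟩

lemma IsNontrivialAlmostInvariant.side (h : IsNontrivialAlmostInvariant H X) (b : Bool) :
    IsNontrivialAlmostInvariant H (side X b) := by
  cases b
  · exact h.compl
  · exact h

lemma IsNontrivialAlmostInvariant.nonempty (h : IsNontrivialAlmostInvariant H X) : X.Nonempty := by
  rw [Set.nonempty_iff_ne_empty]
  rintro rfl
  exact h.not_isHFinite isHFinite_empty

/-- An `H`-finite subset of `V` is `L`-finite if it can be moved off `V` by boundedly long right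
translations, which is so as soon as `V` misses almost all of some `H`-invariant, `H`-infinite
set `P`. -/
lemma IsHFinite.transfer (hP : ∀ h ∈ H, h • P = P) (hP' : ¬ IsHFinite H P)
    (hVP : IsHFinite H (V ∩ P)) (hZ : IsHFinite H Z) (hZV : Z ⊆ V) (hV : IsAlmostInvariant L V) :
    IsHFinite L Z := by
  obtain ⟨F, hF⟩ := hZ
  obtain ⟨F', hF'⟩ := hVP
  -- Right multiplication by `f⁻¹ * p` takes `h * f` to `h * p`, which lies in `P`; were it also in
  -- `V`, `p` would lie in `H * F'`.
  obtain ⟨p, hp, hpF⟩ : ∃ p ∈ P, p ∉ (H : Set G) * (F' : Set G) := by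
    by_contra! hcon
    exact hP' ⟨F', hcon⟩
  refine (isHFinite_biUnion F.finite_toSet
    (fun f _ => hV.isHFinite_boundary (f⁻¹ * p))).mono fun x hx => ?_
  obtain ⟨h, hh, f, hf, rfl⟩ := Set.mem_mul.1 (hF hx)
  refine Set.mem_biUnion hf ⟨hZV hx, fun hmem => hpF ?_⟩
  have hmem' : h * p ∈ V := by simpa [mul_assoc] using hmem
  obtain ⟨k, hk, f', hf', hkf⟩ := Set.mem_mul.1 (hF' ⟨hmem', mem_of_smul_eq (hP h hh) hp⟩)
  exact Set.mem_mul.2 ⟨h⁻¹ * k, H.mul_mem (H.inv_mem hh) hk, f', hf', by rw [mul_assoc, hkf]; simp⟩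

/-- Smallness of `U ∩ V` does not depend on which of the two sets is used to measure it. -/
lemma IsHFinite.inter_symm (hU : IsNontrivialAlmostInvariant H U) (hV : IsAlmostInvariant L V)
    (h : IsHFinite H (U ∩ V)) : IsHFinite L (U ∩ V) :=
  IsHFinite.transfer hU.left_invariant hU.not_isHFinite (by rwa [Set.inter_comm]) h
    Set.inter_subset_right hV

/-- Equivalent almost invariant sets have the same small sets. -/
lemma IsHFinite.of_almostEqual (hU : IsNontrivialAlmostInvariant H U)
    (hV : IsAlmostInvariant L V) (h : IsHAlmostEqual H U V) (hW : IsHFinite H W) :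
    IsHFinite L W := by
  -- `V` is almost disjoint from `Uᶜ`, and `Vᶜ` from `U`; these complementary pieces serve as the
  -- set `P` of `IsHFinite.transfer`.
  have h1 : IsHFinite L (W ∩ V) :=
    IsHFinite.transfer hU.compl.left_invariant hU.compl.not_isHFinite
      (h.mono fun x hx => Or.inr ⟨hx.1, hx.2⟩) (hW.mono Set.inter_subset_left)
      Set.inter_subset_right hV
  have h2 : IsHFinite L (W ∩ Vᶜ) :=
    IsHFinite.transfer hU.left_invariant hU.not_isHFinite
      (h.mono fun x hx => Or.inl ⟨hx.2, hx.1⟩) (hW.mono Set.inter_subset_left)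
      Set.inter_subset_right hV.compl
  exact (h1.union h2).mono fun x hx => by
    by_cases hxV : x ∈ V
    · exact Or.inl ⟨hx, hxV⟩
    · exact Or.inr ⟨hx, hxV⟩

lemma isHAlmostEqual_refl : IsHAlmostEqual H U U := by
  simpa [IsHAlmostEqual] using isHFinite_empty

lemma IsHAlmostEqual.symm (h : IsHAlmostEqual H U V) : IsHAlmostEqual H V U := by
  rwa [IsHAlmostEqual, symmDiff_comm]

lemma IsHAlmostEqual.trans (h : IsHAlmostEqual H U V) (h' : IsHAlmostEqual H V W) :
    IsHAlmostEqual H U W :=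
  (IsHFinite.union h h').mono (symmDiff_triangle U V W)

lemma IsHAlmostEqual.compl (h : IsHAlmostEqual H U V) : IsHAlmostEqual H Uᶜ Vᶜ := by
  rwa [IsHAlmostEqual, compl_symmDiff_compl]

lemma IsNontrivialAlmostInvariant.of_isHAlmostEqual (hX : IsNontrivialAlmostInvariant H X)
    (hY : ∀ h ∈ H, h • Y = Y) (h : IsHAlmostEqual H X Y) : IsNontrivialAlmostInvariant H Y := by
  refine isNontrivialAlmostInvariant_iff.2 ⟨isAlmostInvariant_iff.2 ⟨hY, fun g => ?_⟩, ?_, ?_⟩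
  · refine (((hX.isHFinite_boundary g).union h).union (IsHFinite.of_mul_right g h)).mono
      fun x hx => ?_
    have h1 : x ∈ Y := hx.1
    have h2 : x * g ∉ Y := hx.2
    simp only [Set.mem_union, Set.mem_ofPred_eq, Set.mem_symmDiff]
    tauto
  · intro hfin
    refine hX.not_isHFinite ((hfin.union h).mono fun x hx => ?_)
    simp only [Set.mem_union, Set.mem_symmDiff]
    tauto
  · intro hfin
    refine hX.not_isHFinite_compl ((hfin.union h).mono fun x hx => ?_)
    have : x ∉ X := hx
    simp only [Set.mem_union, Set.mem_symmDiff, Set.mem_compl_iff]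
    tauto

/-- `U` is a nontrivial almost invariant set over its stabilizer. -/
def IsNontrivialSet (U : Set G) : Prop := IsNontrivialAlmostInvariant (stabilizer G U) U

/-- `U` and `V` differ by a set that is finite modulo the stabilizer of `U`. -/
def AlmostEq (U V : Set G) : Prop := IsHAlmostEqual (stabilizer G U) U V

lemma IsNontrivialAlmostInvariant.le_stabilizer (h : IsNontrivialAlmostInvariant H U) :
    H ≤ stabilizer G U := fun k hk => h.left_invariant k hk

lemma IsHFinite.of_subgroup (hL : IsHFinite H (L : Set G)) (hW : IsHFinite L W) :
    IsHFinite H W := by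
  classical
  obtain ⟨F, hF⟩ := hL
  obtain ⟨F', hF'⟩ := hW
  refine ⟨F * F', hF'.trans ?_⟩
  rw [Finset.coe_mul, ← mul_assoc]
  exact Set.mul_subset_mul_right hF

/-- An element `k` of the stabilizer keeps `k * x` in `U` and `k * z` outside it, so `k * x` lies in
the `H`-finite boundary for the step `x⁻¹ * z`. Thus `H` may be replaced by the stabilizer, a choice
that depends on `U` alone. -/
lemma IsNontrivialAlmostInvariant.isHFinite_stabilizer (hU : IsNontrivialAlmostInvariant H U) :
    IsHFinite H (stabilizer G U : Set G) := by
  obtain ⟨x, hx⟩ := hU.nonempty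
  obtain ⟨z, hz⟩ := hU.compl.nonempty
  refine ((hU.isHFinite_boundary (x⁻¹ * z)).of_mul_right x).mono fun k hk => ?_
  have hk' : k • U = U := hk
  refine ⟨mem_of_smul_eq hk' hx, ?_⟩
  rw [mul_assoc, mul_inv_cancel_left, mul_mem_iff_of_smul_eq hk']
  exact hz

lemma IsNontrivialAlmostInvariant.isHFinite_iff (hU : IsNontrivialAlmostInvariant H U) :
    IsHFinite (stabilizer G U) W ↔ IsHFinite H W :=
  ⟨fun hW => hU.isHFinite_stabilizer.of_subgroup hW, fun hW => hW.of_le hU.le_stabilizer⟩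

lemma IsNontrivialAlmostInvariant.isNontrivialSet (hU : IsNontrivialAlmostInvariant H U) :
    IsNontrivialSet U :=
  isNontrivialAlmostInvariant_iff.2
    ⟨isAlmostInvariant_iff.2 ⟨fun _ hk => hk, fun g => hU.isHFinite_iff.2 (hU.isHFinite_boundary g)⟩,
      fun h => hU.not_isHFinite (hU.isHFinite_iff.1 h),
      fun h => hU.not_isHFinite_compl (hU.isHFinite_iff.1 h)⟩

lemma isSmall_iff (hU : IsNontrivialSet U) : IsSmall U V ↔ IsHFinite (stabilizer G U) (U ∩ V) :=
  ⟨fun ⟨_, hH, h⟩ => hH.isHFinite_iff.2 h, fun h => ⟨_, hU, h⟩⟩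

lemma stabilizer_compl (U : Set G) : stabilizer G Uᶜ = stabilizer G U := by
  ext g
  simp [mem_stabilizer_iff]

lemma IsNontrivialSet.compl (hU : IsNontrivialSet U) : IsNontrivialSet Uᶜ :=
  IsNontrivialAlmostInvariant.isNontrivialSet (IsNontrivialAlmostInvariant.compl hU)

lemma IsNontrivialSet.side (hU : IsNontrivialSet U) (b : Bool) : IsNontrivialSet (side U b) :=
  IsNontrivialAlmostInvariant.isNontrivialSet (IsNontrivialAlmostInvariant.side hU b)

lemma isSmall_symm (hU : IsNontrivialSet U) (hV : IsNontrivialSet V) :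
    IsSmall U V ↔ IsSmall V U := by
  rw [isSmall_iff hU, isSmall_iff hV]
  refine ⟨fun h => ?_, fun h => ?_⟩
  · rw [Set.inter_comm]
    exact IsHFinite.inter_symm hU hV.1 h
  · rw [Set.inter_comm]
    exact IsHFinite.inter_symm hV hU.1 h

lemma isSmall_of_inter_eq_empty (hU : IsNontrivialSet U) (h : U ∩ V = ∅) : IsSmall U V := by
  rw [isSmall_iff hU, h]
  exact isHFinite_empty

lemma not_isSmall_and_isSmall_compl (hU : IsNontrivialSet U) :
    ¬ (IsSmall U V ∧ IsSmall U Vᶜ) := by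
  rw [isSmall_iff hU, isSmall_iff hU]
  rintro ⟨h1, h2⟩
  refine IsNontrivialAlmostInvariant.not_isHFinite hU ((h1.union h2).mono ?_)
  rw [← Set.inter_union_distrib_left, Set.union_compl_self, Set.inter_univ]

lemma AlmostEq.of_isSmall (hU : IsNontrivialSet U) (h1 : IsSmall U Vᶜ) (h2 : IsSmall Uᶜ V) :
    AlmostEq U V := by
  rw [isSmall_iff hU] at h1
  rw [isSmall_iff hU.compl, stabilizer_compl] at h2
  exact (h1.union h2).mono fun x hx => hx.imp id fun h => ⟨h.2, h.1⟩

lemma AlmostEq.isHFinite_iff (hU : IsNontrivialSet U) (hV : IsNontrivialSet V)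
    (h : AlmostEq U V) : IsHFinite (stabilizer G U) W ↔ IsHFinite (stabilizer G V) W := by
  refine ⟨IsHFinite.of_almostEqual hU hV.1 h, ?_⟩
  exact IsHFinite.of_almostEqual hV hU.1
    (IsHAlmostEqual.symm (IsHFinite.of_almostEqual hU hV.1 h h))

lemma AlmostEq.symm (hU : IsNontrivialSet U) (hV : IsNontrivialSet V) (h : AlmostEq U V) :
    AlmostEq V U :=
  IsHAlmostEqual.symm ((h.isHFinite_iff hU hV).1 h)

lemma AlmostEq.trans (hU : IsNontrivialSet U) (hV : IsNontrivialSet V) (h : AlmostEq U V)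
    (h' : AlmostEq V W) : AlmostEq U W :=
  IsHAlmostEqual.trans h ((h.isHFinite_iff hU hV).2 h')

lemma AlmostEq.compl (h : AlmostEq U V) : AlmostEq Uᶜ Vᶜ := by
  rw [AlmostEq, stabilizer_compl]
  exact IsHAlmostEqual.compl h

lemma IsHFinite.smul (g : G) (h : IsHFinite (stabilizer G U) W) :
    IsHFinite (stabilizer G (g • U)) (g • W) := by
  classical
  obtain ⟨F, hF⟩ := h
  refine ⟨g • F, ?_⟩
  rintro _ ⟨x, hx, rfl⟩
  obtain ⟨k, hk, f, hf, rfl⟩ := Set.mem_mul.1 (hF hx)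
  have hk' : k • U = U := hk
  refine Set.mem_mul.2 ⟨g * k * g⁻¹, ?_, g * f, ?_, ?_⟩
  · change (g * k * g⁻¹) • g • U = g • U
    rw [smul_smul, inv_mul_cancel_right, mul_smul, hk']
  · rw [Finset.coe_smul_finset]
    exact Set.smul_mem_smul_set hf
  · simp [mul_assoc]

lemma IsHFinite.smul_iff (g : G) : IsHFinite (stabilizer G (g • U)) (g • W) ↔
    IsHFinite (stabilizer G U) W := by
  refine ⟨fun h => ?_, IsHFinite.smul g⟩
  simpa using h.smul g⁻¹

lemma IsNontrivialSet.smul (hU : IsNontrivialSet U) (g : G) : IsNontrivialSet (g • U) := by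
  refine isNontrivialAlmostInvariant_iff.2 ⟨isAlmostInvariant_iff.2 ⟨fun _ hk => hk, fun γ => ?_⟩,
    fun h => ?_, fun h => ?_⟩
  · refine ((IsAlmostInvariant.isHFinite_boundary hU.1 γ).smul g).mono fun x hx => ?_
    have h1 : x ∈ g • U := hx.1
    have h2 : x * γ ∉ g • U := hx.2
    rw [Set.mem_smul_set_iff_inv_smul_mem] at *
    exact ⟨h1, by simpa [mul_assoc] using h2⟩
  · exact IsNontrivialAlmostInvariant.not_isHFinite hU ((IsHFinite.smul_iff g).1 h)
  · rw [← Set.smul_set_compl] at h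
    exact IsNontrivialAlmostInvariant.not_isHFinite_compl hU ((IsHFinite.smul_iff g).1 h)

lemma AlmostEq.smul (h : AlmostEq U V) (g : G) : AlmostEq (g • U) (g • V) := by
  rw [AlmostEq, IsHAlmostEqual, ← Set.smul_set_symmDiff]
  exact IsHFinite.smul g h

end Basic

/-! ### From nesting of almost equal sets to good position and a partial order -/

section NestedFamily

variable {G : Type*} [Group G] {U V W : Set G}

lemma AlmostLE.isSmall (hU : IsNontrivialSet U) (h : AlmostLE U V) : IsSmall U Vᶜ := by
  rcases h with h | h
  · exact isSmall_of_inter_eq_empty hU h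
  · exact (h (true, false)).2 rfl

lemma AlmostLE.subset_of_isSmall (h : AlmostLE U V) (h' : IsSmall Uᶜ V) : U ⊆ V := by
  rcases h with h | h
  · exact Set.sdiff_eq_empty.1 h
  · exact absurd ((h (false, true)).1 h') (by decide)

lemma AlmostLE.refl (U : Set G) : AlmostLE U U := Or.inl (Set.inter_compl_self U)

/-- Both relations together make two opposite corners small, so neither is the only small one and
both relations are inclusions. -/
lemma AlmostLE.antisymm (hU : IsNontrivialSet U) (hV : IsNontrivialSet V) (h : AlmostLE U V)
    (h' : AlmostLE V U) : U = V :=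
  (h.subset_of_isSmall ((isSmall_symm hU.compl hV).2 (h'.isSmall hV))).antisymm
    (h'.subset_of_isSmall ((isSmall_symm hV.compl hU).2 (h.isSmall hU)))

/-- The intersection `U ∩ W*` is small if `U ∩ V*` and `V ∩ W*` are. -/
lemma isSmall_compl_trans (hU : IsNontrivialSet U) (hV : IsNontrivialSet V)
    (h : IsSmall U Vᶜ) (h' : IsSmall V Wᶜ) : IsSmall U Wᶜ := by
  have h₁ := (isSmall_iff hV.compl).1 ((isSmall_symm hU hV.compl).1 h)
  rw [isSmall_iff hU] at h ⊢
  rw [isSmall_iff hV] at h'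
  rw [stabilizer_compl, Set.inter_comm] at h₁
  -- This piece is finite over the stabilizer of `V`; since `U` misses almost all of `Vᶜ`,
  -- finiteness transfers to the stabilizer of `U`.
  have h₂ : IsHFinite (stabilizer G U) (U ∩ (V ∩ Wᶜ)) :=
    IsHFinite.transfer (IsNontrivialAlmostInvariant.compl hV).left_invariant
      (IsNontrivialAlmostInvariant.not_isHFinite_compl hV) h₁ (h'.mono Set.inter_subset_right)
      Set.inter_subset_left hU.1
  refine (h.union h₂).mono fun x hx => ?_
  by_cases hxV : x ∈ V
  · exact Or.inr ⟨hx.1, hxV, hx.2⟩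
  · exact Or.inl ⟨hx.1, hxV⟩

lemma IsSmall.mono_right {V' : Set G} (hU : IsNontrivialSet U) (h : IsSmall U V) (hV : V' ⊆ V) :
    IsSmall U V' := by
  rw [isSmall_iff hU] at h ⊢
  exact h.mono (Set.inter_subset_inter_right _ hV)

/-- Two distinct small corners of a pair are opposite. -/
lemma CornerSmall.opposite (hU : IsNontrivialSet U) (hV : IsNontrivialSet V) {c d : Bool × Bool}
    (hcd : c ≠ d) (hc : CornerSmall U V c) (hd : CornerSmall U V d) : d = (!c.1, !c.2) := by
  obtain ⟨a, b⟩ := c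
  obtain ⟨a', b'⟩ := d
  -- Adjacent corners together fill a side, which is never small.
  have key : ∀ (a : Bool), ¬ (CornerSmall U V (a, true) ∧ CornerSmall U V (a, false)) :=
    fun a => not_isSmall_and_isSmall_compl (hU.side a)
  have key' : ∀ (b : Bool), ¬ (CornerSmall U V (true, b) ∧ CornerSmall U V (false, b)) := by
    rintro b ⟨h1, h2⟩
    exact not_isSmall_and_isSmall_compl (hV.side b) ⟨(isSmall_symm (hU.side true) (hV.side b)).1 h1,
      (isSmall_symm (hU.side false) (hV.side b)).1 h2⟩
  cases a <;> cases b <;> cases a' <;> cases b' <;> first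
    | exact absurd rfl hcd
    | rfl
    | exact (key _ ⟨hc, hd⟩).elim
    | exact (key _ ⟨hd, hc⟩).elim
    | exact (key' _ ⟨hc, hd⟩).elim
    | exact (key' _ ⟨hd, hc⟩).elim

lemma AlmostEq.of_cornerSmall (hU : IsNontrivialSet U) (hV : IsNontrivialSet V)
    {c d : Bool × Bool} (hcd : c ≠ d) (hc : CornerSmall U V c) (hd : CornerSmall U V d) :
    AlmostEq (side U c.1) (side V !c.2) := by
  have hd' := CornerSmall.opposite hU hV hcd hc hd
  subst hd'
  refine AlmostEq.of_isSmall (hU.side _) ?_ ?_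
  · rw [side_not, compl_compl]
    exact hc
  · rw [← side_not]
    exact hd

variable {E : Set (Set G)}

/-- If almost equal members of a family are nested, the family satisfies the condition of
good position. -/
lemma exists_corner_eq_empty (hE : ∀ U ∈ E, IsNontrivialSet U) (hEc : ∀ U ∈ E, Uᶜ ∈ E)
    (hnest : ∀ U ∈ E, ∀ V ∈ E, AlmostEq U V → U ⊆ V ∨ V ⊆ U) (hU : U ∈ E) (hV : V ∈ E)
    {c d : Bool × Bool} (hcd : c ≠ d) (hc : CornerSmall U V c) (hd : CornerSmall U V d) :
    ∃ e, corner U V e = ∅ := by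
  have hmem : ∀ W ∈ E, ∀ b, side W b ∈ E := by
    intro W hW b
    cases b
    · exact hEc W hW
    · exact hW
  rcases hnest _ (hmem U hU c.1) _ (hmem V hV _)
    (AlmostEq.of_cornerSmall (hE U hU) (hE V hV) hcd hc hd) with h | h
  · refine ⟨c, ?_⟩
    rw [side_not] at h
    exact Set.disjoint_iff_inter_eq_empty.1 (Set.subset_compl_iff_disjoint_right.1 h)
  · refine ⟨(!c.1, !c.2), ?_⟩
    change side U (!c.1) ∩ side V (!c.2) = ∅
    rw [side_not U, Set.inter_comm]
    exact Set.sdiff_eq_empty.2 h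

lemma AlmostLE.trans (hE : ∀ U ∈ E, IsNontrivialSet U)
    (hnest : ∀ U ∈ E, ∀ V ∈ E, AlmostEq U V → U ⊆ V ∨ V ⊆ U) (hU : U ∈ E) (hV : V ∈ E)
    (hW : W ∈ E) (hUV : AlmostLE U V) (hVW : AlmostLE V W) : AlmostLE U W := by
  have nU := hE U hU
  have nV := hE V hV
  have nW := hE W hW
  have hs : IsSmall U Wᶜ := isSmall_compl_trans nU nV (hUV.isSmall nU) (hVW.isSmall nV)
  by_cases hsub : U ⊆ W
  · exact Or.inl (Set.sdiff_eq_empty.2 hsub)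
  refine Or.inr fun c => ⟨fun hc => ?_, fun hc => hc ▸ hs⟩
  by_contra hne
  have hop : IsSmall Uᶜ W := by
    have := CornerSmall.opposite nU nW (c := (true, false)) (Ne.symm hne) hs hc
    subst this
    exact hc
  have hWU : W ⊆ U := (hnest U hU W hW (AlmostEq.of_isSmall nU hs hop)).resolve_left hsub
  -- With `W ⊆ U` almost equal, `V` is squeezed between them, so both given relations must be
  -- inclusions.
  have h1 : IsSmall Uᶜ V := (isSmall_symm nU.compl nV).2
    ((hVW.isSmall nV).mono_right nV (Set.compl_subset_compl.2 hWU))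
  have h2 : IsSmall Vᶜ W :=
    ((isSmall_symm nU nV.compl).1 (hUV.isSmall nU)).mono_right nV.compl hWU
  exact hsub ((hUV.subset_of_isSmall h1).trans (hVW.subset_of_isSmall h2))

end NestedFamily

/-! ### Boundaries and connectedness in the Cayley graph -/

section Boundary

variable {G : Type*} [Group G] {H : Subgroup G} {S : Set G} {U V X : Set G}

/-- The points `x` for which some edge from `x` to `xs`, `s ∈ S`, leaves or enters `V`. -/
def stepBoundary (S V : Set G) : Set G := {x | ∃ s ∈ S, ¬(x ∈ V ↔ x * s ∈ V)}

lemma mem_iff_of_notMem_stepBoundary {x s : G} (h : x ∉ stepBoundary S V) (hs : s ∈ S) :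
    x * s ∈ V ↔ x ∈ V := by
  by_contra hcon
  exact h ⟨s, hs, fun h => hcon h.symm⟩

lemma stepBoundary_compl (S V : Set G) : stepBoundary S Vᶜ = stepBoundary S V := by
  ext x
  simp only [stepBoundary, Set.mem_ofPred_eq, Set.mem_compl_iff, not_iff_not]

lemma stepBoundary_side (S V : Set G) (b : Bool) : stepBoundary S (side V b) = stepBoundary S V := by
  cases b
  · exact stepBoundary_compl S V
  · rfl

lemma stepBoundary_smul (S V : Set G) (g : G) : stepBoundary S (g • V) = g • stepBoundary S V := by
  ext x
  simp only [stepBoundary, Set.mem_ofPred_eq, Set.mem_smul_set_iff_inv_smul_mem, smul_eq_mul,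
    mul_assoc]

lemma IsAlmostInvariant.isHFinite_stepBoundary (hX : IsAlmostInvariant H X) (hS : S.Finite) :
    IsHFinite H (stepBoundary S X) := by
  refine (isHFinite_biUnion hS fun s _ =>
    (hX.isHFinite_boundary s).union (hX.compl.isHFinite_boundary s)).mono ?_
  rintro x ⟨s, hs, hx⟩
  refine Set.mem_biUnion hs ?_
  simp only [Set.mem_union, Set.mem_ofPred_eq, Set.mem_compl_iff]
  tauto

/-- `B` is the vertex set of a path from `1` to `g` in the Cayley graph: a translate of the path
that avoids the boundary of `V` cannot change sides. -/
lemma exists_finset_connected (hS : Subgroup.closure S = ⊤) (g : G) :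
    ∃ B : Finset G, g ∈ B ∧ ∀ (x : G) (V : Set G), (∀ b ∈ B, x * b ∉ stepBoundary S V) →
      ∀ b ∈ B, (x * b ∈ V ↔ x ∈ V) := by
  classical
  have hg : g ∈ Subgroup.closure S := hS ▸ Subgroup.mem_top g
  induction hg using Subgroup.closure_induction_right with
  | one => exact ⟨{1}, by simp, by simp⟩
  | mul_right y hy s hs ih =>
    obtain ⟨B, hyB, hB⟩ := ih
    refine ⟨insert (y * s) B, Finset.mem_insert_self _ _, fun x V hx b hb => ?_⟩
    have hB' := hB x V fun b hb => hx b (Finset.mem_insert_of_mem hb)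
    rcases Finset.mem_insert.1 hb with rfl | hb
    · rw [← hB' y hyB, ← mul_assoc]
      exact mem_iff_of_notMem_stepBoundary (hx y (Finset.mem_insert_of_mem hyB)) hs
    · exact hB' b hb
  | mul_inv_cancel y hy s hs ih =>
    obtain ⟨B, hyB, hB⟩ := ih
    refine ⟨insert (y * s⁻¹) B, Finset.mem_insert_self _ _, fun x V hx b hb => ?_⟩
    have hB' := hB x V fun b hb => hx b (Finset.mem_insert_of_mem hb)
    rcases Finset.mem_insert.1 hb with rfl | hb
    · rw [← hB' y hyB]
      simpa [mul_assoc] using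
        (mem_iff_of_notMem_stepBoundary (hx (y * s⁻¹) (Finset.mem_insert_self _ _)) hs).symm
    · exact hB' b hb

/-- The boundary of an almost invariant set over a finitely generated subgroup `H` lies in a
connected `H`-finite set `HB`: if `HB` misses the boundary of `V`, it is on one side of `V`. -/
lemma IsAlmostInvariant.exists_connected_neighborhood (hX : IsAlmostInvariant H X) (hS : S.Finite)
    (hSG : Subgroup.closure S = ⊤) {A : Set G} (hAS : A ⊆ S) (hA : Subgroup.closure A = H) :
    ∃ B : Finset G, stepBoundary S X ⊆ (H : Set G) * (B : Set G) ∧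
      ∀ V, Disjoint ((H : Set G) * (B : Set G)) (stepBoundary S V) →
        (H : Set G) * (B : Set G) ⊆ V ∨ (H : Set G) * (B : Set G) ⊆ Vᶜ := by
  classical
  obtain ⟨F, hF⟩ := hX.isHFinite_stepBoundary hS
  choose B hBmem hB using exists_finset_connected (S := S) hSG
  -- Paths lead from `H` to each point of `H * F`. Inserting `1` makes the neighbourhood contain
  -- `H`, which is connected because `S` contains generators of `H`.
  refine ⟨(insert 1 F).biUnion B, hF.trans (Set.mul_subset_mul_left fun f hf => ?_),
    fun V hV => ?_⟩
  · exact Finset.mem_coe.2 (Finset.mem_biUnion.2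
      ⟨f, Finset.mem_insert_of_mem (Finset.mem_coe.1 hf), hBmem f⟩)
  rw [Set.disjoint_left] at hV
  have hH : ∀ h ∈ H, h ∉ stepBoundary S V := fun h hh => hV (Set.mem_mul.2 ⟨h, hh, 1,
    Finset.mem_coe.2 (Finset.mem_biUnion.2 ⟨1, Finset.mem_insert_self _ _, hBmem 1⟩), mul_one h⟩)
  have hH' : ∀ h ∈ H, (h ∈ V ↔ 1 ∈ V) := by
    intro h hh
    rw [← hA] at hh
    induction hh using Subgroup.closure_induction_right with
    | one => rfl
    | mul_right y hy s hs ih =>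
      exact (mem_iff_of_notMem_stepBoundary (hH y (hA ▸ hy)) (hAS hs)).trans ih
    | mul_inv_cancel y hy s hs ih =>
      have hmem : y * s⁻¹ ∈ H := hA ▸ mul_mem hy (inv_mem (Subgroup.subset_closure hs))
      have := mem_iff_of_notMem_stepBoundary (hH _ hmem) (hAS hs)
      rw [inv_mul_cancel_right] at this
      exact this.symm.trans ih
  have hall : ∀ x ∈ (H : Set G) * (((insert 1 F).biUnion B : Finset G) : Set G),
      (x ∈ V ↔ 1 ∈ V) := by
    intro x hx
    obtain ⟨h, hh, b, hb, rfl⟩ := Set.mem_mul.1 hx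
    obtain ⟨f, hf, hbf⟩ := Finset.mem_biUnion.1 (Finset.mem_coe.1 hb)
    refine (hB f h V (fun b' hb' => hV (Set.mem_mul.2 ⟨h, hh, b', ?_, rfl⟩)) b hbf).trans
      (hH' h hh)
    exact Finset.mem_coe.2 (Finset.mem_biUnion.2 ⟨f, hf, hb'⟩)
  by_cases h1 : (1 : G) ∈ V
  · exact Or.inl fun x hx => (hall x hx).2 h1
  · exact Or.inr fun x hx hxV => h1 ((hall x hx).1 hxV)

lemma eq_empty_or_univ_of_forall_mul_mem_iff (hSG : Subgroup.closure S = ⊤)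
    (hV : ∀ x, ∀ s ∈ S, (x * s ∈ V ↔ x ∈ V)) : V = ∅ ∨ V = Set.univ := by
  have key : ∀ x : G, (x ∈ V ↔ 1 ∈ V) := by
    intro x
    have hx : x ∈ Subgroup.closure S := hSG ▸ Subgroup.mem_top x
    induction hx using Subgroup.closure_induction_right with
    | one => rfl
    | mul_right y hy s hs ih => exact (hV y s hs).trans ih
    | mul_inv_cancel y hy s hs ih =>
      refine Iff.trans ?_ ih
      simpa using (hV (y * s⁻¹) s hs).symm
  by_cases h1 : (1 : G) ∈ V
  · exact Or.inr (Set.eq_univ_of_forall fun x => (key x).2 h1)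
  · exact Or.inl (Set.eq_empty_of_forall_notMem fun x hx => h1 ((key x).1 hx))

/-- `U ∩ V` has no boundary: near the boundary of `U` one stays in `Vᶜ`, and near that of `V` one
stays in `Uᶜ`. By connectedness it is empty or everything. -/
lemma inter_eq_empty_of_disjoint {M N : Set G} (hSG : Subgroup.closure S = ⊤)
    (hM : stepBoundary S U ⊆ M) (hN : stepBoundary S V ⊆ N) (hMN : Disjoint M N)
    (hMV : M ⊆ Vᶜ) (hNU : N ⊆ Uᶜ) (hU : Uᶜ.Nonempty) : U ∩ V = ∅ := by
  rw [Set.disjoint_left] at hMN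
  refine (eq_empty_or_univ_of_forall_mul_mem_iff hSG fun x s hs => ?_).resolve_right ?_
  · by_cases hxU : x ∈ stepBoundary S U
    · have h1 := hMV (hM hxU)
      have h2 := mem_iff_of_notMem_stepBoundary (fun h => hMN (hM hxU) (hN h)) hs (V := V)
      exact ⟨fun h => absurd (h2.1 h.2) h1, fun h => absurd h.2 h1⟩
    · by_cases hxV : x ∈ stepBoundary S V
      · have h1 := hNU (hN hxV)
        have h2 := mem_iff_of_notMem_stepBoundary hxU hs
        exact ⟨fun h => absurd (h2.1 h.1) h1, fun h => absurd h.1 h1⟩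
      · exact and_congr (mem_iff_of_notMem_stepBoundary hxU hs)
          (mem_iff_of_notMem_stepBoundary hxV hs)
  · intro h
    obtain ⟨x, hx⟩ := hU
    exact hx (h ▸ Set.mem_univ x : x ∈ U ∩ V).1

/-- Almost equal sets whose boundaries have disjoint connected neighbourhoods are nested. -/
lemma AlmostEq.subset_or_subset {M N : Set G} (hSG : Subgroup.closure S = ⊤)
    (nU : IsNontrivialSet U) (h : AlmostEq U V)
    (hM : stepBoundary S U ⊆ M) (hN : stepBoundary S V ⊆ N) (hMN : Disjoint M N)
    (hMV : M ⊆ V ∨ M ⊆ Vᶜ) (hNU : N ⊆ U ∨ N ⊆ Uᶜ) : U ⊆ V ∨ V ⊆ U := by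
  have hUne : U.Nonempty := IsNontrivialAlmostInvariant.nonempty nU
  have hUcne : Uᶜ.Nonempty := IsNontrivialAlmostInvariant.nonempty nU.compl
  have hM' : stepBoundary S Uᶜ ⊆ M := by rwa [stepBoundary_compl]
  have hN' : stepBoundary S Vᶜ ⊆ N := by rwa [stepBoundary_compl]
  have hUne' : Uᶜᶜ.Nonempty := by rwa [compl_compl]
  -- In each case one corner is empty. Two cases give nesting; in the others `Uᶜ` or `U` would lie
  -- in the symmetric difference, against nontriviality.
  rcases hMV with hMV | hMV <;> rcases hNU with hNU | hNU
  · have := inter_eq_empty_of_disjoint hSG hM' hN' hMN (by rwa [compl_compl])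
      (by rwa [compl_compl]) hUne'
    refine absurd (h.mono fun x hx => Or.inr ⟨?_, hx⟩)
      (IsNontrivialAlmostInvariant.not_isHFinite_compl nU)
    by_contra hxV
    exact (this ▸ ⟨hx, hxV⟩ : x ∈ (∅ : Set G))
  · have := inter_eq_empty_of_disjoint hSG hM hN' hMN (by rwa [compl_compl]) hNU hUcne
    exact Or.inl (Set.sdiff_eq_empty.1 this)
  · refine Or.inr (Set.sdiff_eq_empty.1 ?_)
    have := inter_eq_empty_of_disjoint hSG hM' hN hMN hMV (by rwa [compl_compl]) hUne'
    rwa [Set.inter_comm] at this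
  · have := inter_eq_empty_of_disjoint hSG hM hN hMN hMV hNU hUcne
    refine absurd (h.mono fun x hx => Or.inl ⟨hx, fun hxV => ?_⟩)
      (IsNontrivialAlmostInvariant.not_isHFinite nU)
    exact (this ▸ ⟨hx, hxV⟩ : x ∈ (∅ : Set G))

end Boundary

/-! ### Finiteness of separating and of non-nested translates -/

section Finiteness

variable {G : Type*} [Group G] {ι : Type*} {H : ι → Subgroup G} {X : ι → Set G}

lemma mem_translates_iff {U : Set G} :
    U ∈ translates X ↔ ∃ (g : G) (i : ι) (b : Bool), U = g • side (X i) b := by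
  constructor
  · rintro ⟨g, i, h | h⟩
    · exact ⟨g, i, true, h⟩
    · exact ⟨g, i, false, h⟩
  · rintro ⟨g, i, b, h⟩
    cases b
    · exact ⟨g, i, Or.inr h⟩
    · exact ⟨g, i, Or.inl h⟩

lemma smul_mem_translates {U : Set G} (g : G) (hU : U ∈ translates X) : g • U ∈ translates X := by
  obtain ⟨k, i, b, rfl⟩ := mem_translates_iff.1 hU
  exact mem_translates_iff.2 ⟨g * k, i, b, by rw [mul_smul]⟩

lemma compl_mem_translates {U : Set G} (hU : U ∈ translates X) : Uᶜ ∈ translates X := by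
  obtain ⟨k, i, b, rfl⟩ := mem_translates_iff.1 hU
  exact mem_translates_iff.2 ⟨k, i, !b, by rw [side_not, Set.smul_set_compl]⟩

lemma isNontrivialSet_of_mem_translates (hX : ∀ i, IsNontrivialAlmostInvariant (H i) (X i))
    {U : Set G} (hU : U ∈ translates X) : IsNontrivialSet U := by
  obtain ⟨k, i, b, rfl⟩ := mem_translates_iff.1 hU
  exact ((hX i).isNontrivialSet.side b).smul k

/-- Two points are separated by finitely many translates only. -/
lemma finite_translates_separating [Finite ι]
    (hX : ∀ i, IsNontrivialAlmostInvariant (H i) (X i)) (x y : G) :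
    {U ∈ translates X | x ∈ U ∧ y ∉ U}.Finite := by
  choose F hF using fun p : ι × Bool => ((hX p.1).side p.2).isHFinite_boundary (x⁻¹ * y)
  refine (Set.finite_iUnion fun p : ι × Bool =>
    (F p).finite_toSet.image fun f => (x * f⁻¹) • side (X p.1) p.2).subset ?_
  rintro _ ⟨hU, hx, hy⟩
  obtain ⟨k, i, b, rfl⟩ := mem_translates_iff.1 hU
  rw [Set.mem_smul_set_iff_inv_smul_mem, smul_eq_mul] at hx hy
  obtain ⟨h, hh, f, hf, hkx⟩ := Set.mem_mul.1
    (hF (i, b) (show k⁻¹ * x ∈ _ from ⟨hx, by simpa [mul_assoc] using hy⟩))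
  refine Set.mem_iUnion.2 ⟨(i, b), f, hf, ?_⟩
  have hk : x * f⁻¹ = k * h := by
    rw [mul_inv_eq_iff_eq_mul, mul_assoc, hkx, mul_inv_cancel_left]
  change (x * f⁻¹) • side (X i) b = k • side (X i) b
  rw [hk, mul_smul, ((hX i).side b).left_invariant h hh]

lemma finite_orbit {H : Subgroup G} {Y : Set G} (h : IsHFinite (stabilizer G Y) (H : Set G)) :
    {U | ∃ k ∈ H, U = k • Y}.Finite := by
  obtain ⟨F, hF⟩ := h
  refine (F.finite_toSet.image fun f => f⁻¹ • Y).subset ?_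
  rintro _ ⟨k, hk, rfl⟩
  obtain ⟨l, hl, f, hf, hlf⟩ := Set.mem_mul.1 (hF (H.inv_mem hk))
  have hl' : l⁻¹ • Y = Y := (stabilizer G Y).inv_mem hl
  refine ⟨f, hf, ?_⟩
  change f⁻¹ • Y = k • Y
  rw [← inv_inv k, ← hlf, mul_inv_rev, mul_smul, hl']

/-- Only finitely many translates almost equal to `X j` are not nested with it. -/
lemma finite_translates_incomparable [Finite ι] [Group.FG G] (hH : ∀ i, (H i).FG)
    (hX : ∀ i, IsNontrivialAlmostInvariant (H i) (X i)) (j : ι) :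
    {V ∈ translates X | AlmostEq (X j) V ∧ ¬ (X j ⊆ V ∨ V ⊆ X j)}.Finite := by
  classical
  obtain ⟨S₀, hS₀⟩ := (Group.FG.out : (⊤ : Subgroup G).FG)
  choose A hA using hH
  let S : Set G := (S₀ : Set G) ∪ ⋃ i, (A i : Set G)
  have hS : S.Finite := S₀.finite_toSet.union (Set.finite_iUnion fun i => (A i).finite_toSet)
  have hSG : Subgroup.closure S = ⊤ :=
    top_unique (hS₀ ▸ Subgroup.closure_mono Set.subset_union_left)
  choose B hB hBV using fun i => (hX i).exists_connected_neighborhood hS hSG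
    ((Set.subset_iUnion (fun i => (A i : Set G)) i).trans Set.subset_union_right) (hA i)
  -- Neighbourhoods that meet determine the translate up to the action of `H j` and finitely many
  -- quotients `b * b'⁻¹`. Almost equality is built into `Q` because it makes each `H j`-orbit
  -- finite.
  let Q : Set (G × ι × Bool) := {q | AlmostEq (X j) (q.1 • side (X q.2.1) q.2.2) ∧
    ∃ b ∈ B j, ∃ b' ∈ B q.2.1, q.1 = b * b'⁻¹}
  have hQ : Q.Finite := by
    refine (Set.finite_iUnion fun p : ι × Bool => ((B j * (B p.1)⁻¹).finite_toSet.image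
      fun c => (c, p))).subset ?_
    rintro ⟨c, p⟩ ⟨-, b, hb, b', hb', hc⟩
    change c = b * b'⁻¹ at hc
    refine Set.mem_iUnion.2 ⟨p, c, ?_, rfl⟩
    rw [hc]
    exact Finset.mem_coe.2 (Finset.mul_mem_mul hb (Finset.inv_mem_inv hb'))
  refine (hQ.biUnion (t := fun q => {U | ∃ k ∈ H j, U = k • q.1 • side (X q.2.1) q.2.2})
    fun q hq => finite_orbit ?_).subset ?_
  · refine (hq.1.isHFinite_iff (hX j).isNontrivialSet
      (((hX _).isNontrivialSet.side _).smul _)).1 ?_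
    exact (isHFinite_self (H j)).of_le (hX j).le_stabilizer
  · rintro _ ⟨hV, hjV, hne⟩
    obtain ⟨k, i, b, rfl⟩ := mem_translates_iff.1 hV
    have hnd : ¬ Disjoint ((H j : Set G) * (B j : Set G)) (k • ((H i : Set G) * (B i : Set G))) := by
      intro hd
      have hbd : stepBoundary S (k • side (X i) b) ⊆ k • ((H i : Set G) * (B i : Set G)) := by
        rw [stepBoundary_smul, stepBoundary_side]
        exact Set.smul_set_mono (hB i)
      refine hne (hjV.subset_or_subset hSG (hX j).isNontrivialSet (hB j) hbd hd
        (hBV j _ (hd.mono_right hbd)) ?_)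
      have := hBV i (k⁻¹ • X j) (by
        rw [stepBoundary_smul, ← Set.disjoint_smul_set (a := k), smul_inv_smul]
        exact (hd.mono_left (hB j)).symm)
      rw [← Set.smul_set_compl] at this
      simpa only [Set.subset_smul_set_iff, inv_inv] using this
    obtain ⟨_, hx, y, hy, hxy⟩ := Set.not_disjoint_iff.1 hnd
    obtain ⟨h, hh, c, hc, rfl⟩ := Set.mem_mul.1 hx
    obtain ⟨h', hh', c', hc', rfl⟩ := Set.mem_mul.1 hy
    have hk : k • side (X i) b = h • (c * c'⁻¹) • side (X i) b := by
      have hk' : h * (c * c'⁻¹) = k * h' := by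
        rw [← mul_assoc, ← hxy]
        simp [mul_assoc]
      rw [smul_smul, hk', mul_smul, ((hX i).side b).left_invariant h' hh']
    refine Set.mem_biUnion (x := (c * c'⁻¹, i, b)) ⟨?_, c, hc, c', hc', rfl⟩ ⟨h, hh, hk⟩
    have := hjV.smul h⁻¹
    rwa [hk, inv_smul_smul, (hX j).left_invariant _ ((H j).inv_mem hh)] at this

end Finiteness

/-! ### The depth preorder of a family of sets -/

section Depth

variable {α : Type*} {T : Set (Set α)} {P Q : Set α} {x y z : α}

/-- The members of `T` that contain `x` but not `y`. -/
def separating (T : Set (Set α)) (x y : α) : Set (Set α) := {V ∈ T | x ∈ V ∧ y ∉ V}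

/-- The point `x` lies in at least as many members of `T` as `y` does, where members that contain
both points or neither of them are disregarded. -/
def Deeper (T : Set (Set α)) (x y : α) : Prop :=
  (separating T y x).ncard ≤ (separating T x y).ncard

lemma ncard_separating_split (hT : ∀ x y, (separating T x y).Finite) (x y z : α) :
    {V ∈ T | x ∈ V ∧ y ∉ V ∧ z ∈ V}.ncard + {V ∈ T | x ∈ V ∧ y ∉ V ∧ z ∉ V}.ncard =
      (separating T x y).ncard := by
  rw [← Set.ncard_inter_add_ncard_sdiff_eq_ncard (separating T x y) {V | z ∈ V} (hT x y)]
  congr 2 <;> ext V <;>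
    simp only [separating, Set.mem_inter_iff, Set.mem_sdiff, Set.mem_ofPred_eq] <;> tauto

/-- The signed count of sets containing `x` but not `y`, minus those containing `y` but not `x`, is
additive along `x, y, z`. This is seen by splitting every count according to the third point. -/
lemma Deeper.trans (hT : ∀ x y, (separating T x y).Finite) (hxy : Deeper T x y)
    (hyz : Deeper T y z) : Deeper T x z := by
  have swap : ∀ (x y : α) (p : Set α → Prop),
      {V ∈ T | x ∈ V ∧ y ∉ V ∧ p V} = {V ∈ T | p V ∧ y ∉ V ∧ x ∈ V} := by
    intro x y p
    ext V
    simp only [Set.mem_ofPred_eq]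
    tauto
  have swap' : ∀ x y z : α,
      {V ∈ T | x ∈ V ∧ y ∉ V ∧ z ∉ V} = {V ∈ T | x ∈ V ∧ z ∉ V ∧ y ∉ V} := by
    intro x y z
    ext V
    simp only [Set.mem_ofPred_eq]
    tauto
  have h1 := ncard_separating_split hT x y z
  have h2 := ncard_separating_split hT y z x
  have h3 := ncard_separating_split hT z x y
  have h4 := ncard_separating_split hT y x z
  have h5 := ncard_separating_split hT z y x
  have h6 := ncard_separating_split hT x z y
  rw [swap z y (x ∈ ·), swap' z y x] at h5
  rw [swap x z (y ∈ ·), swap' x z y] at h6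
  rw [swap y x (z ∈ ·), swap' y x z] at h4
  unfold Deeper at *
  omega

/-- `P` is closed under passing to deeper points. -/
def IsDeepClosed (T : Set (Set α)) (P : Set α) : Prop := ∀ x y, y ∈ P → Deeper T x y → x ∈ P

lemma IsDeepClosed.subset_or_subset (hP : IsDeepClosed T P) (hQ : IsDeepClosed T Q) :
    P ⊆ Q ∨ Q ⊆ P := by
  by_contra! h
  obtain ⟨⟨p, hp, hpQ⟩, q, hq, hqP⟩ := h.imp Set.not_subset.1 Set.not_subset.1
  rcases le_total (separating T q p).ncard (separating T p q).ncard with h | h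
  · exact hpQ (hQ p q hq h)
  · exact hqP (hP q p hp h)

/-- The points at least as deep as some point of `P`. -/
def deepClosure (T : Set (Set α)) (P : Set α) : Set α := {x | ∃ y ∈ P, Deeper T x y}

lemma subset_deepClosure : P ⊆ deepClosure T P := fun x hx => ⟨x, hx, le_rfl⟩

lemma isDeepClosed_deepClosure (hT : ∀ x y, (separating T x y).Finite) :
    IsDeepClosed T (deepClosure T P) :=
  fun _ _ ⟨w, hw, hyw⟩ hxy => ⟨w, hw, hxy.trans hT hyw⟩

/-- A point of the deep closure of `P ∈ T` that is not in `P` lies in a member of `T` that is not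
nested with `P`. -/
lemma exists_mem_of_mem_deepClosure (hT : ∀ x y, (separating T x y).Finite) (hP : P ∈ T)
    (hx : x ∈ deepClosure T P) (hxP : x ∉ P) : ∃ V ∈ T, ¬ (P ⊆ V ∨ V ⊆ P) ∧ x ∈ V := by
  obtain ⟨y, hy, hxy⟩ := hx
  by_contra! hcon
  -- A member containing `x` but not `y` cannot be nested with `P`, which contains `y` but not `x`.
  -- With none of these, depth forbids members containing `y` but not `x`, yet `P` is one.
  have h0 : separating T x y = ∅ := by
    refine Set.eq_empty_of_forall_notMem fun V hV => ?_
    exact hcon V hV.1 ⟨fun h => hV.2.2 (h hy), fun h => hxP (h hV.2.1)⟩ hV.2.1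
  have h1 : separating T y x = ∅ := by
    rw [Deeper, h0, Set.ncard_empty, Nat.le_zero, Set.ncard_eq_zero (hT y x)] at hxy
    exact hxy
  exact (h1 ▸ ⟨hP, hy, hxP⟩ : P ∈ (∅ : Set (Set α)))

end Depth

/-! ### Deep closures of the given sets -/

section Construction

variable {G : Type*} [Group G] {ι : Type*} {H : ι → Subgroup G} {X : ι → Set G} {U V P : Set G}

/-- The translates of the family `X` that are almost equal to `U`. -/
def almostEqClass (X : ι → Set G) (U : Set G) : Set (Set G) := {V ∈ translates X | AlmostEq U V}

lemma almostEqClass_congr (nU : IsNontrivialSet U) (nV : IsNontrivialSet V) (h : AlmostEq U V) :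
    almostEqClass X U = almostEqClass X V := by
  ext W
  exact and_congr_right fun _ => ⟨(h.symm nU nV).trans nV nU, h.trans nU nV⟩

lemma separating_almostEqClass_smul (g x y : G) :
    separating (almostEqClass X (g • U)) (g * x) (g * y) =
      (g • ·) '' separating (almostEqClass X U) x y := by
  ext V
  constructor
  · rintro ⟨⟨hV, hUV⟩, hx, hy⟩
    refine ⟨g⁻¹ • V, ⟨⟨smul_mem_translates _ hV, by simpa using hUV.smul g⁻¹⟩, ?_, ?_⟩,
      smul_inv_smul g V⟩
    · rwa [Set.mem_inv_smul_set_iff]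
    · rwa [Set.mem_inv_smul_set_iff]
  · rintro ⟨W, ⟨⟨hW, hUW⟩, hx, hy⟩, rfl⟩
    exact ⟨⟨smul_mem_translates g hW, hUW.smul g⟩, Set.smul_mem_smul_set hx,
      fun h => hy (Set.smul_mem_smul_set_iff.1 h)⟩

lemma deeper_almostEqClass_smul (g x y : G) :
    Deeper (almostEqClass X (g • U)) (g * x) (g * y) ↔ Deeper (almostEqClass X U) x y := by
  rw [Deeper, Deeper, separating_almostEqClass_smul, separating_almostEqClass_smul,
    Set.ncard_image_of_injective _ (MulAction.injective g),
    Set.ncard_image_of_injective _ (MulAction.injective g)]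

lemma separating_almostEqClass_compl (x y : G) :
    separating (almostEqClass X Uᶜ) x y = compl '' separating (almostEqClass X U) y x := by
  ext V
  constructor
  · rintro ⟨⟨hV, hUV⟩, hx, hy⟩
    exact ⟨Vᶜ, ⟨⟨compl_mem_translates hV, by simpa using hUV.compl⟩, hy, fun h => h hx⟩,
      compl_compl V⟩
  · rintro ⟨W, ⟨⟨hW, hUW⟩, hx, hy⟩, rfl⟩
    exact ⟨⟨compl_mem_translates hW, hUW.compl⟩, hy, fun h => h hx⟩

lemma deeper_almostEqClass_compl (x y : G) :
    Deeper (almostEqClass X Uᶜ) x y ↔ Deeper (almostEqClass X U) y x := by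
  rw [Deeper, Deeper, separating_almostEqClass_compl, separating_almostEqClass_compl,
    Set.ncard_image_of_injective _ compl_injective,
    Set.ncard_image_of_injective _ compl_injective]

lemma IsDeepClosed.smul (h : IsDeepClosed (almostEqClass X U) P) (g : G) :
    IsDeepClosed (almostEqClass X (g • U)) (g • P) := by
  intro x y hy hxy
  rw [Set.mem_smul_set_iff_inv_smul_mem, smul_eq_mul] at hy ⊢
  refine h _ _ hy ?_
  rw [← deeper_almostEqClass_smul g]
  simpa using hxy

lemma IsDeepClosed.compl (h : IsDeepClosed (almostEqClass X U) P) :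
    IsDeepClosed (almostEqClass X Uᶜ) Pᶜ :=
  fun x y hy hxy hx => hy (h y x hx ((deeper_almostEqClass_compl x y).1 hxy))

/-- For `g` in the subgroup over which `U` is invariant, this makes the deep closure invariant too,
so the original subgroups can be kept. -/
lemma smul_deepClosure (g : G) :
    g • deepClosure (almostEqClass X U) U = deepClosure (almostEqClass X (g • U)) (g • U) := by
  ext x
  rw [Set.mem_smul_set_iff_inv_smul_mem, smul_eq_mul]
  constructor
  · rintro ⟨y, hy, hxy⟩
    refine ⟨g * y, Set.smul_mem_smul_set hy, ?_⟩
    simpa using (deeper_almostEqClass_smul g _ _).2 hxy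
  · rintro ⟨_, ⟨y, hy, rfl⟩, hxy⟩
    refine ⟨y, hy, ?_⟩
    rw [← deeper_almostEqClass_smul g]
    simpa using hxy

lemma finite_separating_almostEqClass [Finite ι]
    (hX : ∀ i, IsNontrivialAlmostInvariant (H i) (X i)) (U : Set G) (x y : G) :
    (separating (almostEqClass X U) x y).Finite :=
  (finite_translates_separating hX x y).subset fun _ hV => ⟨hV.1.1, hV.2⟩

lemma isHAlmostEqual_deepClosure [Finite ι] [Group.FG G] (hH : ∀ i, (H i).FG)
    (hX : ∀ i, IsNontrivialAlmostInvariant (H i) (X i)) (i : ι) :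
    IsHAlmostEqual (H i) (X i) (deepClosure (almostEqClass X (X i)) (X i)) := by
  have hmem : X i ∈ almostEqClass X (X i) :=
    ⟨mem_translates_iff.2 ⟨1, i, true, (one_smul _ _).symm⟩, isHAlmostEqual_refl⟩
  refine (isHFinite_biUnion (finite_translates_incomparable hH hX i)
    (f := fun V => V \ X i) fun V hV => ?_).mono ?_
  · exact ((hX i).isHFinite_iff.1 hV.2.1).mono fun x hx => Or.inr hx
  · rintro x (⟨h1, h2⟩ | ⟨h1, h2⟩)
    · exact absurd (subset_deepClosure h1) h2
    · obtain ⟨V, hV, hne, hxV⟩ := exists_mem_of_mem_deepClosure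
        (finite_separating_almostEqClass hX (X i)) hmem h1 h2
      exact Set.mem_biUnion (⟨hV.1, hV.2, hne⟩ : V ∈ {V ∈ translates X | _}) ⟨hxV, h2⟩

/-- Only closedness is recorded, not being a deep closure: it survives complementation, since
complementing the class reverses depth. -/
lemma exists_isDeepClosed [Finite ι] [Group.FG G] (hH : ∀ i, (H i).FG)
    (hX : ∀ i, IsNontrivialAlmostInvariant (H i) (X i)) {W : Set G}
    (hW : W ∈ translates fun i => deepClosure (almostEqClass X (X i)) (X i)) :
    ∃ U ∈ translates X, AlmostEq U W ∧ IsDeepClosed (almostEqClass X U) W := by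
  obtain ⟨g, i, b, rfl⟩ := mem_translates_iff.1 hW
  have heq : AlmostEq (X i) (deepClosure (almostEqClass X (X i)) (X i)) :=
    (isHAlmostEqual_deepClosure hH hX i).of_le (hX i).le_stabilizer
  have hcl := isDeepClosed_deepClosure (P := X i) (finite_separating_almostEqClass hX (X i))
  refine ⟨g • side (X i) b, mem_translates_iff.2 ⟨g, i, b, rfl⟩, ?_, ?_⟩
  · refine AlmostEq.smul ?_ g
    cases b
    · exact heq.compl
    · exact heq
  · refine IsDeepClosed.smul ?_ g
    cases b
    · exact hcl.compl
    · exact hcl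

end Construction

end AlmostInvariant

/-! ### The main theorem -/

open AlmostInvariant in
theorem mainTheorem4 {G : Type*} [Group G] [Group.FG G] (n : ℕ)
    (H : Fin n → Subgroup G) (hH : ∀ i, (H i).FG)
    (X : Fin n → Set G)
    (hX : ∀ i, AlmostInvariant.IsNontrivialAlmostInvariant (H i) (X i)) :
    ∃ (K : Fin n → Subgroup G) (Y : Fin n → Set G),
      (∀ i, (K i).FG) ∧
      (∀ i, AlmostInvariant.IsNontrivialAlmostInvariant (K i) (Y i)) ∧
      (∀ i, AlmostInvariant.IsEquivalent (H i) (K i) (X i) (Y i)) ∧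
      AlmostInvariant.InGoodPosition Y ∧
      IsPartialOrder (AlmostInvariant.translates Y)
        (fun U V => AlmostInvariant.AlmostLE (U : Set G) (V : Set G)) := by
  have heq := isHAlmostEqual_deepClosure hH hX
  have hY : ∀ i, IsNontrivialAlmostInvariant (H i)
      (deepClosure (almostEqClass X (X i)) (X i)) := fun i =>
    (hX i).of_isHAlmostEqual
      (fun h hh => by rw [smul_deepClosure, (hX i).left_invariant h hh]) (heq i)
  have hE := fun U => isNontrivialSet_of_mem_translates hY (U := U)
  have hnest : ∀ U ∈ translates fun i => deepClosure (almostEqClass X (X i)) (X i),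
      ∀ V ∈ translates fun i => deepClosure (almostEqClass X (X i)) (X i),
        AlmostEq U V → U ⊆ V ∨ V ⊆ U := by
    intro U hU V hV hUV
    obtain ⟨U', hU', hUU', hcU⟩ := exists_isDeepClosed hH hX hU
    obtain ⟨V', hV', hVV', hcV⟩ := exists_isDeepClosed hH hX hV
    have nU' := isNontrivialSet_of_mem_translates hX hU'
    have nV' := isNontrivialSet_of_mem_translates hX hV'
    have h : AlmostEq U' V' := (hUU'.trans nU' (hE U hU) hUV).trans nU' (hE V hV)
      (hVV'.symm nV' (hE V hV))
    -- `U'` and `V'` have the same class, so `U` and `V` are closed for a single total preorder.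
    rw [almostEqClass_congr nU' nV' h] at hcU
    exact hcU.subset_or_subset hcV
  refine ⟨H, fun i => deepClosure (almostEqClass X (X i)) (X i), hH, hY,
    fun i => ⟨(hX i).1, (hY i).1, heq i⟩, ?_, ?_⟩
  · intro U hU V hV c d hcd hc hd
    exact exists_corner_eq_empty hE (fun _ => compl_mem_translates) hnest hU hV hcd hc hd
  · exact
      { refl := fun U => AlmostLE.refl _
        trans := fun U V W => AlmostLE.trans hE hnest U.2 V.2 W.2
        antisymm := fun U V h h' => Subtype.ext (h.antisymm (hE _ U.2) (hE _ V.2) h') }
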